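/- **Theorem 1.** Let $(M,g)$ and $(\overline M,\bar g)$ be smooth manifolds of the same dimension $n\ge 3$ with smooth pseudo-Riemannian metrics (symmetric, nondegenerate), the metric $g$ of $M$ being indefinite at every point. A plane is a $2$-dimensional subspace $\alpha$ of a tangent space; it is called nondegenerate, resp. weakly degenerate, if the restriction of the metric to $\alpha$ has rank $2$, resp. $1$. For a nondegenerate plane $\alpha$ with basis $\{x,y\}$ let $$K(\alpha)=\frac{R(x,y,y,x)}{g(x,x)g(y,y)-g(x,y)^2}$$ be its sectional curvature, where $R$ is the curvature tensor of the Levi-Civita connection; $\overline K$ denotes the sectional curvature of $\overline M$. Suppose that $M$ is nowhere of constant sectional curvature, i.e. every nonempty open subset of $M$ contains a point $p$ such that $K$ is not constant on the set of nondegenerate planes in $T_pM$. Let $f:M\to\overline M$ be a diffeomorphism such that for every $p\in M$ and every weakly degenerate plane $\alpha_0\subset T_pM$ $$\lim_{\alpha\to\alpha_0}\frac{\overline K(f_*\alpha)}{K(\alpha)}=1,\qquad (2.1)$$ where $\alpha$ runs over the planes in $T_pM$ for which the quotient is defined, i.e. $\alpha$ and $f_*\alpha$ are nondegenerate and $K(\alpha)\neq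 0$. Then $f$ is conformal: there are a smooth function $\sigma$ on $M$ and a locally constant function $\varepsilon:M\to\{1,-1\}$ (so a constant sign if $M$ is connected) such that $f^*\bar g=\varepsilon e^{2\sigma}g$. -/

import Mathlib

open scoped Manifold ContDiff Topology
open Set Filter Bundle

noncomputable section

/-! ### Planes (two-dimensional subspaces) and their topology -/

/-- The Grassmannian of planes, i.e. two-dimensional subspaces, of a real vector space. -/
def Plane (V : Type*) [AddCommGroup V] [Module ℝ V] : Type _ :=
  {α : Submodule ℝ V // Module.finrank ℝ α = 2}

namespace Plane

variable {V W : Type*} [AddCommGroup V] [Module ℝ V] [AddCommGroup W] [Module ℝ W]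

/-- The plane spanned by a linearly independent pair of vectors. -/
def span (b : {b : Fin 2 → V // LinearIndependent ℝ b}) : Plane V :=
  ⟨Submodule.span ℝ (Set.range b.1), by
    rw [finrank_span_eq_card b.2, Fintype.card_fin]⟩

/-- The usual topology of the Grassmannian: the quotient topology from the space of linearly
independent pairs of vectors. -/
instance [TopologicalSpace V] : TopologicalSpace (Plane V) :=
  TopologicalSpace.coinduced span inferInstance

/-- The image of a plane under a linear isomorphism. -/
def map (e : V ≃ₗ[ℝ] W) (α : Plane V) : Plane W :=
  ⟨α.1.map (e : V →ₗ[ℝ] W), by rw [LinearEquiv.finrank_map_eq, α.2]⟩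

/-- A basis of a plane. -/
def basis (α : Plane V) : Module.Basis (Fin 2) ℝ α.1 :=
  haveI : Module.Finite ℝ α.1 := Module.finite_of_finrank_eq_succ α.2
  Module.finBasisOfFinrankEq ℝ α.1 α.2

end Plane

/-! ### Pseudo-Riemannian metrics -/

/-- A smooth pseudo-Riemannian metric (of any signature) on a smooth `n`-manifold: a smooth field
of nondegenerate symmetric bilinear forms on the tangent spaces. -/
structure PseudoRiemannianMetric (n : ℕ) (M : Type*) [TopologicalSpace M]
    [ChartedSpace (EuclideanSpace ℝ (Fin n)) M] [IsManifold (𝓡 n) ∞ M] where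
  /-- The bilinear form on each tangent space. -/
  val (p : M) : TangentSpace (𝓡 n) p →L[ℝ] TangentSpace (𝓡 n) p →L[ℝ] ℝ
  symm (p : M) (v w : TangentSpace (𝓡 n) p) : val p v w = val p w v
  nondegenerate (p : M) (v : TangentSpace (𝓡 n) p) (hv : ∀ w, val p v w = 0) : v = 0
  contMDiff : ContMDiff (𝓡 n)
    ((𝓡 n).prod 𝓘(ℝ, EuclideanSpace ℝ (Fin n) →L[ℝ] EuclideanSpace ℝ (Fin n) →L[ℝ] ℝ)) ∞
    (fun p ↦ TotalSpace.mk'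
      (EuclideanSpace ℝ (Fin n) →L[ℝ] EuclideanSpace ℝ (Fin n) →L[ℝ] ℝ) p (val p))

namespace PseudoRiemannianMetric

variable {n : ℕ} {M : Type*} [TopologicalSpace M] [ChartedSpace (EuclideanSpace ℝ (Fin n)) M]
  [IsManifold (𝓡 n) ∞ M] (g : PseudoRiemannianMetric n M)

/-- The metric is indefinite: it takes both signs on every tangent space. -/
def IsIndefinite : Prop :=
  ∀ p : M, (∃ v, 0 < g.val p v v) ∧ (∃ v, g.val p v v < 0)

/-! #### The curvature tensor of the Levi-Civita connection -/

/-- The metric in the preferred chart `φ` at `p`, i.e. its pullback under `φ⁻¹` to an open subset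
of `ℝⁿ`; the value at `y` is the bilinear form with entries `g_ij(y)`. -/
def coord (p : M) (y : EuclideanSpace ℝ (Fin n)) :
    EuclideanSpace ℝ (Fin n) →L[ℝ] EuclideanSpace ℝ (Fin n) →L[ℝ] ℝ :=
  let d : EuclideanSpace ℝ (Fin n) →L[ℝ] EuclideanSpace ℝ (Fin n) :=
    mfderiv 𝓘(ℝ, EuclideanSpace ℝ (Fin n)) (𝓡 n) (extChartAt (𝓡 n) p).symm y
  let b : EuclideanSpace ℝ (Fin n) →L[ℝ] EuclideanSpace ℝ (Fin n) →L[ℝ] ℝ :=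
    g.val ((extChartAt (𝓡 n) p).symm y)
  b.bilinearComp d d

/-- The Christoffel symbols of the first kind, in the preferred chart at `p`: the covector
`w ↦ (∂_u g(v, w) + ∂_v g(u, w) - ∂_w g(u, v)) / 2`. -/
def christoffelLower (p : M) (y u v : EuclideanSpace ℝ (Fin n)) :
    EuclideanSpace ℝ (Fin n) →L[ℝ] ℝ :=
  (1 / 2 : ℝ) • (fderiv ℝ (g.coord p) y u v + fderiv ℝ (g.coord p) y v u
    - ((fderiv ℝ (g.coord p) y).flip u).flip v)

/-- The Christoffel symbols of the second kind, in the preferred chart at `p`: the vector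
`Γ(u, v) = ∇_u v` at `y`, for constant vector fields `u`, `v`. -/
def christoffel (p : M) (y u v : EuclideanSpace ℝ (Fin n)) : EuclideanSpace ℝ (Fin n) :=
  (g.coord p y).inverse (g.christoffelLower p y u v)

/-- The curvature operator `R(u, v)w = ∇_u ∇_v w - ∇_v ∇_u w - ∇_[u, v] w` at `p`, computed in the
preferred chart at `p`. (The identification of `T_p M` with `ℝⁿ` by this chart is the definition
of the tangent space.) -/
def curvatureOperator (p : M) (u v w : TangentSpace (𝓡 n) p) : TangentSpace (𝓡 n) p :=
  let y : EuclideanSpace ℝ (Fin n) := extChartAt (𝓡 n) p p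
  let Γ : EuclideanSpace ℝ (Fin n) → EuclideanSpace ℝ (Fin n) → EuclideanSpace ℝ (Fin n) →
    EuclideanSpace ℝ (Fin n) := g.christoffel p
  fderiv ℝ (fun z ↦ Γ z v w) y u - fderiv ℝ (fun z ↦ Γ z u w) y v
    + Γ y u (Γ y v w) - Γ y v (Γ y u w)

/-- The curvature tensor of type (0,4), `R(x, y, z, u) = g(R(x, y)z, u)`. -/
def curvature (p : M) (x y z u : TangentSpace (𝓡 n) p) : ℝ :=
  g.val p (g.curvatureOperator p x y z) u

/-- The tensor `π₁(z, u, v, w) = g(z, w) g(u, v) - g(z, v) g(u, w)`. -/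
def pi₁ (p : M) (z u v w : TangentSpace (𝓡 n) p) : ℝ :=
  g.val p z w * g.val p u v - g.val p z v * g.val p u w

/-! #### Planes in tangent spaces and sectional curvature -/

/-- The rank of the restriction of the metric to a plane. -/
def rankOn (p : M) (α : Plane (TangentSpace (𝓡 n) p)) : ℕ :=
  Module.finrank ℝ (LinearMap.range ((g.val p).toBilinForm.restrict α.1))

/-- The restriction of the metric to the plane has rank 2. -/
def IsNondegeneratePlane (p : M) (α : Plane (TangentSpace (𝓡 n) p)) : Prop :=
  g.rankOn p α = 2

/-- The restriction of the metric to the plane has rank 1. -/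
def IsWeaklyDegeneratePlane (p : M) (α : Plane (TangentSpace (𝓡 n) p)) : Prop :=
  g.rankOn p α = 1

/-- The sectional curvature `K(α) = R(x, y, y, x) / π₁(x, y, y, x)`, where `{x, y}` is a basis
of `α` (meaningful if `α` is nondegenerate; independent of the basis). -/
def sectionalCurvature (p : M) (α : Plane (TangentSpace (𝓡 n) p)) : ℝ :=
  let x : TangentSpace (𝓡 n) p := (α.basis 0 : α.1)
  let y : TangentSpace (𝓡 n) p := (α.basis 1 : α.1)
  g.curvature p x y y x / g.pi₁ p x y y x

/-- `M` is of constant sectional curvature in the point `p`: all nondegenerate planes in `T_p M`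
have the same sectional curvature. -/
def IsOfConstantCurvatureAt (p : M) : Prop :=
  ∃ c : ℝ, ∀ α : Plane (TangentSpace (𝓡 n) p),
    g.IsNondegeneratePlane p α → g.sectionalCurvature p α = c

/-- `M` is nowhere of constant sectional curvature: there is no nonempty open set in all points
of which the sectional curvature is constant. -/
def NowhereOfConstantCurvature : Prop :=
  ∀ U : Set M, IsOpen U → U.Nonempty → ¬ ∀ p ∈ U, g.IsOfConstantCurvatureAt p

/-! #### Diffeomorphisms -/

variable {N : Type*} [TopologicalSpace N] [ChartedSpace (EuclideanSpace ℝ (Fin n)) N]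
  [IsManifold (𝓡 n) ∞ N] (g' : PseudoRiemannianMetric n N)

/-- The image `f_* α` of a plane under the differential of a diffeomorphism. -/
def pushPlane (f : M ≃ₘ^∞⟮𝓡 n, 𝓡 n⟯ N) (p : M) (α : Plane (TangentSpace (𝓡 n) p)) :
    Plane (TangentSpace (𝓡 n) (f p)) :=
  α.map (f.mfderivToContinuousLinearEquiv (by simp) p).toLinearEquiv

/-- The planes at which the quotient `K'(f_* α) / K(α)` is defined: `α` and `f_* α` are
nondegenerate and `K(α) ≠ 0`. -/
def quotientDomain (f : M ≃ₘ^∞⟮𝓡 n, 𝓡 n⟯ N) (p : M) : Set (Plane (TangentSpace (𝓡 n) p)) :=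
  {α | g.IsNondegeneratePlane p α ∧ g'.IsNondegeneratePlane (f p) (pushPlane f p α) ∧
    g.sectionalCurvature p α ≠ 0}

/-- The condition `lim_{α → α₀} K'(f_* α) / K(α) = 1`. -/
def LimitCondition (f : M ≃ₘ^∞⟮𝓡 n, 𝓡 n⟯ N) (p : M) (α₀ : Plane (TangentSpace (𝓡 n) p)) :
    Prop :=
  Tendsto (fun α ↦ g'.sectionalCurvature (f p) (pushPlane f p α) / g.sectionalCurvature p α)
    (𝓝[quotientDomain g g' f p] α₀) (𝓝 1)

/-- `f` is conformal: `f^* g' = ε e^{2σ} g` with a smooth function `σ` and a sign `ε = ± 1`, which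
is constant on every connected component. -/
def IsConformal (f : M ≃ₘ^∞⟮𝓡 n, 𝓡 n⟯ N) : Prop :=
  ∃ (ε σ : M → ℝ), IsLocallyConstant ε ∧ (∀ p, ε p = 1 ∨ ε p = -1) ∧
    ContMDiff (𝓡 n) 𝓘(ℝ, ℝ) ∞ σ ∧
    ∀ (p : M) (v w : TangentSpace (𝓡 n) p),
      g'.val (f p) (mfderiv (𝓡 n) (𝓡 n) f p v) (mfderiv (𝓡 n) (𝓡 n) f p w)
        = ε p * Real.exp (2 * σ p) * g.val p v w

end PseudoRiemannianMetric

end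

noncomputable section

set_option maxSynthPendingDepth 3
set_option linter.unusedSectionVars false

/-! Fix p and let h be the pullback of the second metric to T_pM. Let α₀ be spanned by a null vector
x and a nonnull y orthogonal to x. Along nondegenerate planes tending to α₀ the Gram determinant of
g tends to 0. If R(x,y,y,x) ≠ 0 and h is nondegenerate on α₀, then K blows up there while the second
sectional curvature stays bounded, so the quotient tends to 0 instead of 1. Hence R(x,y,y,x) times
the Gram determinant of h vanishes on every weakly degenerate plane (`curvature_mul_gram_eq_zero`).

Up to scale, the pairs (x,y) with x null and y orthogonal to x are the values of a polynomial map on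
a vector space, where a product of nonzero polynomials is nonzero. So one of the two factors
vanishes on all degenerate planes (`constant_curvature_or_proportional`). If it is R, then K is
constant at p (`IsCurvatureLike.exists_eq_mul_gram`); if it is the Gram determinant of h, then h is
a multiple of g (`exists_eq_mul_of_gram_eq_zero`).

The points where K is not constant are dense and proportionality of h and g is a closed condition,
so h = μg at every point (`pullbackForm_mul_form`). The factor μ is smooth and nowhere zero; its
sign and log|μ|/2 are ε and σ. -/

/-! ### Symmetric bilinear forms and curvature-like tensors -/

/-- The symmetries of a curvature tensor that make `T x y y x` a function of planes: linearity
and skew-symmetry in the first and in the last pair of arguments. -/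
structure IsCurvatureLike {V : Type*} [AddCommGroup V] [Module ℝ V] (T : V → V → V → V → ℝ) :
    Prop where
  add_first (x x' y z w : V) : T (x + x') y z w = T x y z w + T x' y z w
  smul_first (t : ℝ) (x y z w : V) : T (t • x) y z w = t * T x y z w
  add_third (x y z z' w : V) : T x y (z + z') w = T x y z w + T x y z' w
  smul_third (t : ℝ) (x y z w : V) : T x y (t • z) w = t * T x y z w
  swap_left (x y z w : V) : T x y z w = -T y x z w
  swap_right (x y z w : V) : T x y z w = -T x y w z

namespace IsCurvatureLike

variable {V : Type*} [AddCommGroup V] [Module ℝ V] {T : V → V → V → V → ℝ}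
  (hT : IsCurvatureLike T)
include hT

theorem add_second (x y y' z w : V) : T x (y + y') z w = T x y z w + T x y' z w := by
  rw [hT.swap_left, hT.add_first, hT.swap_left x y, hT.swap_left x y']; ring

theorem smul_second (t : ℝ) (x y z w : V) : T x (t • y) z w = t * T x y z w := by
  rw [hT.swap_left, hT.smul_first, hT.swap_left x y]; ring

theorem add_fourth (x y z w w' : V) : T x y z (w + w') = T x y z w + T x y z w' := by
  rw [hT.swap_right, hT.add_third, hT.swap_right x y z w, hT.swap_right x y z w']; ring

theorem smul_fourth (t : ℝ) (x y z w : V) : T x y z (t • w) = t * T x y z w := by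
  rw [hT.swap_right, hT.smul_third, hT.swap_right x y z w]; ring

theorem self_left (x z w : V) : T x x z w = 0 := by linarith [hT.swap_left x x z w]

theorem self_right (x y z : V) : T x y z z = 0 := by linarith [hT.swap_right x y z z]

theorem symm (x y : V) : T x y y x = T y x x y := by
  rw [hT.swap_left, hT.swap_right]; ring

theorem combination (a b c d : ℝ) (x y : V) :
    T (a • x + b • y) (c • x + d • y) (c • x + d • y) (a • x + b • y)
      = (a * d - b * c) ^ 2 * T x y y x := by
  simp only [hT.add_first, hT.add_second, hT.add_third, hT.add_fourth, hT.smul_first,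
    hT.smul_second, hT.smul_third, hT.smul_fourth, hT.self_left, hT.self_right,
    hT.swap_left y x, hT.swap_right _ _ x y]
  ring

theorem quadratic (x y z : V) (s t : ℝ) :
    T x (s • y + t • z) (s • y + t • z) x
      = s ^ 2 * T x y y x + s * t * (T x y z x + T x z y x) + t ^ 2 * T x z z x := by
  simp only [hT.add_second, hT.add_third, hT.smul_second, hT.smul_third]
  ring

end IsCurvatureLike

/-! ### Indefinite forms and their null cones. -/

section Forms

variable {V : Type*} [NormedAddCommGroup V] [NormedSpace ℝ V]

/-- The determinant of the Gram matrix of two vectors. -/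
def gram (g : V →L[ℝ] V →L[ℝ] ℝ) (x y : V) : ℝ := g x x * g y y - g x y ^ 2

theorem isCurvatureLike_gram (g : V →L[ℝ] V →L[ℝ] ℝ) :
    IsCurvatureLike fun x y z w ↦ g x w * g y z - g x z * g y w where
  add_first _ _ _ _ _ := by simp only [map_add, add_apply]; ring
  smul_first _ _ _ _ _ := by
    simp only [map_smul, smul_apply, smul_eq_mul]; ring
  add_third _ _ _ _ _ := by simp only [map_add]; ring
  smul_third _ _ _ _ _ := by simp only [map_smul, smul_eq_mul]; ring
  swap_left _ _ _ _ := by ring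
  swap_right _ _ _ _ := by ring

theorem exists_ne_zero_of_two_functionals (hV : 3 ≤ Module.finrank ℝ V) (φ ψ : V →L[ℝ] ℝ) :
    ∃ z, z ≠ 0 ∧ φ z = 0 ∧ ψ z = 0 := by
  have : FiniteDimensional ℝ V := Module.finite_of_finrank_pos (by omega)
  have h := LinearMap.ker_ne_bot_of_finrank_lt
    (f := (φ : V →ₗ[ℝ] ℝ).prod (ψ : V →ₗ[ℝ] ℝ)) (by simp; omega)
  obtain ⟨z, hz, hz0⟩ := (Submodule.ne_bot_iff _).1 h
  have hz' : φ z = 0 ∧ ψ z = 0 := by simpa using hz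
  exact ⟨z, hz0, hz'⟩

variable {g : V →L[ℝ] V →L[ℝ] ℝ} (hs : ∀ v w, g v w = g w v)

include hs in
/-- A quadratic form vanishing on the null vectors of an indefinite form is a multiple of it. -/
theorem exists_eq_mul_of_vanish_on_null (hi : (∃ v, 0 < g v v) ∧ ∃ v, g v v < 0) (Q : V → ℝ)
    (hQ : ∀ a c, ∃ m : ℝ, ∀ s t : ℝ, Q (s • a + t • c) = s ^ 2 * Q a + s * t * m + t ^ 2 * Q c)
    (h0 : ∀ x, g x x = 0 → Q x = 0) : ∃ μ : ℝ, ∀ v, Q v = μ * g v v := by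
  have key (a c : V) (ha : 0 < g a a) (hc : g c c < 0) : g c c * Q a = g a a * Q c := by
    obtain ⟨m, hm⟩ := hQ a c
    have hD : 0 < g a c ^ 2 - g a a * g c c := by nlinarith [sq_nonneg (g a c)]
    -- The vector g(c,c)a + tc is null for t = -g(a,c) ± r. On this line Q has the same two roots as
    -- g, so the two quadratic polynomials in t are proportional.
    set r := √(g a c ^ 2 - g a a * g c c) with hr
    have hr2 : r ^ 2 = g a c ^ 2 - g a a * g c c := Real.sq_sqrt hD.le
    have hr0 : 0 < r := Real.sqrt_pos.2 hD
    have hroot (t : ℝ) (ht : t ^ 2 + 2 * g a c * t + g a a * g c c = 0) :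
        g c c ^ 2 * Q a + g c c * t * m + t ^ 2 * Q c = 0 := by
      rw [← hm]
      apply h0
      simp only [map_add, map_smul, add_apply, smul_apply,
        smul_eq_mul, hs c a]
      linear_combination g c c * ht
    have h1 := hroot (-g a c + r) (by linear_combination hr2)
    have h2 := hroot (-g a c - r) (by linear_combination hr2)
    have h3 : g c c * m = 2 * g a c * Q c := by
      have : (2 * r) * (g c c * m - 2 * g a c * Q c) = 0 := by linear_combination h1 - h2
      rcases mul_eq_zero.1 this with h | h <;> linarith
    have h4 : g c c * (g c c * Q a - g a a * Q c) = 0 := by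
      linear_combination h1 - (-g a c + r) * h3 - Q c * hr2
    rcases mul_eq_zero.1 h4 with h | h <;> linarith
  obtain ⟨⟨a, ha⟩, c, hc⟩ := hi
  refine ⟨Q a / g a a, fun v ↦ ?_⟩
  have hμc : Q c = Q a / g a a * g c c := by
    have := key a c ha hc
    field_simp; linarith
  rcases lt_trichotomy (g v v) 0 with h | h | h
  · have := key a v ha h
    field_simp; linarith
  · rw [h, h0 v h, mul_zero]
  · have := key v c h hc
    apply mul_left_cancel₀ hc.ne
    rw [this, hμc]; ring

variable (hd : ∀ v, (∀ w, g v w = 0) → v = 0) (hV : 3 ≤ Module.finrank ℝ V)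

include hd in
theorem exists_apply_eq_one {x : V} (hx : x ≠ 0) : ∃ w, g x w = 1 := by
  by_contra! h
  refine hx (hd x fun w ↦ ?_)
  by_contra hw
  exact h ((g x w)⁻¹ • w) (by simp [hw])

include hs hd hV in
-- Otherwise the orthogonal complement of x is totally isotropic. With g(x,y) = 1, a nonzero z
-- orthogonal to x and y is then orthogonal to that complement and to y, hence to everything.
theorem exists_orthogonal_nonnull (x : V) : ∃ z, g x z = 0 ∧ g z z ≠ 0 := by
  by_contra! h
  obtain rfl | hx := eq_or_ne x 0
  · obtain ⟨z, hz0, -⟩ := exists_ne_zero_of_two_functionals hV 0 0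
    refine hz0 (hd z fun w ↦ ?_)
    have h1 := h (z + w) (by simp)
    simp only [map_add, add_apply, h z (by simp), h w (by simp), hs w z] at h1
    linarith
  obtain ⟨y, hy⟩ := exists_apply_eq_one hd hx
  obtain ⟨z, hz0, hxz, hyz⟩ := exists_ne_zero_of_two_functionals hV (g x) (g y)
  refine hz0 (hd z fun w ↦ ?_)
  have hw : g x (w - g x w • y) = 0 := by simp [hy]
  have h1 := h (z + (w - g x w • y)) (by rw [map_add, hxz, hw, add_zero])
  have h2 := h _ hw
  have h3 := h _ hxz
  rw [map_add, map_add, add_apply, add_apply, h2, h3,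
    hs _ z] at h1
  simp only [map_sub, map_smul, smul_eq_mul, hs z y, hyz] at h1
  linarith

include hs hd hV in
-- Otherwise the product g(x,·)g(y,·) vanishes on the null cone and equals μg. A common orthogonal
-- vector of x and y lies in the kernel of μg, so μ = 0; but a product of two nonzero functionals is
-- not zero.
theorem exists_null_nonorthogonal (hi : (∃ v, 0 < g v v) ∧ ∃ v, g v v < 0) {x y : V}
    (hx : x ≠ 0) (hy : y ≠ 0) : ∃ z, g z z = 0 ∧ g x z ≠ 0 ∧ g y z ≠ 0 := by
  by_contra! h
  obtain ⟨μ, hμ⟩ := exists_eq_mul_of_vanish_on_null hs hi (fun z ↦ g x z * g y z)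
    (fun a c ↦ ⟨g x a * g y c + g x c * g y a, fun s t ↦ by
      simp only [map_add, map_smul, smul_eq_mul]; ring⟩)
    (fun z hz ↦ by
      by_cases hxz : g x z = 0
      · simp [hxz]
      · simp [h z hz hxz])
  obtain ⟨z, hz0, hxz, hyz⟩ := exists_ne_zero_of_two_functionals hV (g x) (g y)
  have hμ0 : μ = 0 := by
    by_contra hne
    refine hz0 (hd z fun w ↦ ?_)
    have h1 := hμ (z + w)
    have h2 := hμ z
    simp only [map_add, add_apply, hs w z, hxz, hyz, zero_add] at h1
    rw [hμ w] at h1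
    rw [hxz, zero_mul] at h2
    have : μ * (2 * g z w) = 0 := by linarith
    simpa [hne] using this
  obtain ⟨a, ha⟩ := exists_apply_eq_one hd hx
  obtain ⟨b, hb⟩ := exists_apply_eq_one hd hy
  have h1 := hμ a
  have h2 := hμ b
  have h3 := hμ (a + b)
  simp only [hμ0, zero_mul, ha, hb, one_mul, mul_one, map_add] at h1 h2 h3
  rw [h1, h2] at h3
  norm_num at h3

/-! ### Curvature-like tensors vanishing on degenerate planes. -/

section Constant

variable {T : V → V → V → V → ℝ} (hT : IsCurvatureLike T)
  (h0 : ∀ x y, g x x = 0 → g x y = 0 → T x y y x = 0)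

include hs hT h0 in
-- The null vector x moves along the conic x + tz - (t²/2)g(z,z)y, and z - t g(z,z)y stays
-- orthogonal to it. So T vanishes on this pair for all t, and the coefficient of t gives the claim.
theorem IsCurvatureLike.polar_eq_zero {x y z : V} (hx : g x x = 0) (hy : g y y = 0)
    (hxy : g x y = 1) (hxz : g x z = 0) (hyz : g y z = 0) (hz : g z z ≠ 0) :
    T x z y x + T x y z x = 0 := by
  have key (t : ℝ) := h0 (x + (t • z + (-(t ^ 2 / 2) * g z z) • y)) (z + (-t * g z z) • y)
    (by
      simp only [map_add, map_smul, add_apply,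
        smul_apply, smul_eq_mul, hx, hy, hxy, hxz, hyz, hs z x, hs z y, hs y x]
      ring)
    (by
      simp only [map_add, map_smul, add_apply,
        smul_apply, smul_eq_mul, hy, hxy, hxz, hyz, hs z y]
      ring)
  simp only [hT.add_first, hT.add_second, hT.add_third, hT.add_fourth, hT.smul_first,
    hT.smul_second, hT.smul_third, hT.smul_fourth, hT.self_left, hT.self_right,
    hT.swap_left z y, hT.swap_right _ _ z y
    ] at key
  have e1 := key 1
  have e2 := key (-1)
  have e3 := key 2
  have e4 := key (-2)
  -- The polynomial has degree at most 4 in t; this combination of its values at ±1 and ±2 isolates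
  -- minus the coefficient of t.
  have : g z z * (T x z y x + T x y z x) = 0 := by
    linear_combination (-(2 / 3) : ℝ) * e1 + (2 / 3 : ℝ) * e2 + (1 / 12 : ℝ) * e3
      - (1 / 12 : ℝ) * e4
  exact (mul_eq_zero.1 this).resolve_left hz

include hs hd hV hT h0 in
-- The quadratic form T(x,·,·,x) vanishes on the hyperplane orthogonal to x. It remains to kill the
-- mixed terms between this hyperplane and a vector w with g(x,w) = 1.
theorem IsCurvatureLike.exists_eq_mul_sq {x : V} (hx : g x x = 0) :
    ∃ c : ℝ, ∀ y, T x y y x = c * g x y ^ 2 := by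
  obtain rfl | hx0 := eq_or_ne x 0
  · refine ⟨0, fun y ↦ ?_⟩
    have := hT.smul_first 0 0 y y 0
    simpa using this
  obtain ⟨w, hw⟩ := exists_apply_eq_one hd hx0
  have h1 (z : V) (hz : g x z = 0) (hzz : g z z ≠ 0) : T x z w x + T x w z x = 0 := by
    -- The numbers a and b make w + az + bx null and orthogonal to z, while its product with x
    -- remains 1.
    obtain ⟨a, ha⟩ : ∃ a : ℝ, g w z + a * g z z = 0 := ⟨-(g w z) / g z z, by field_simp; ring⟩
    obtain ⟨b, hb⟩ : ∃ b : ℝ, g w w + 2 * a * g w z + a ^ 2 * g z z + 2 * b = 0 :=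
      ⟨-(g w w + 2 * a * g w z + a ^ 2 * g z z) / 2, by ring⟩
    have := hT.polar_eq_zero hs h0 (x := x) (y := w + (a • z + b • x)) (z := z) hx
      (by
        simp only [map_add, map_smul, add_apply,
          smul_apply, smul_eq_mul, hx, hw, hz, hs z x, hs z w, hs w x]
        linear_combination hb)
      (by simp only [map_add, map_smul, smul_eq_mul, hx, hw, hz]; ring)
      hz
      (by
        simp only [map_add, map_smul, add_apply,
          smul_apply, smul_eq_mul, hz]
        linear_combination ha)
      hzz
    simp only [hT.add_second, hT.add_third, hT.smul_second, hT.smul_third, hT.self_left,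
      hT.self_right, h0 x z hx hz] at this
    linarith
  have h2 (z : V) (hz : g x z = 0) : T x z w x + T x w z x = 0 := by
    obtain ⟨z₀, hz₀, hzz₀⟩ := exists_orthogonal_nonnull hs hd hV x
    -- The mixed term is linear in z, so a null z is handled as a difference of nonnull vectors. If
    -- z + sz₀ were null for s = 0, 1, -1, then z₀ would be null.
    have h3 : ∃ s : ℝ, g (z + s • z₀) (z + s • z₀) ≠ 0 := by
      by_contra! h
      have a1 := h 0
      have a2 := h 1
      have a3 := h (-1)
      simp only [map_add, map_smul, add_apply,
        smul_apply, smul_eq_mul] at a1 a2 a3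
      exact hzz₀ (by linarith)
    obtain ⟨s, hs'⟩ := h3
    have h4 := h1 _ (by simp [hz, hz₀]) hs'
    have h5 := h1 _ hz₀ hzz₀
    simp only [hT.add_second, hT.add_third, hT.smul_second, hT.smul_third] at h4
    linear_combination h4 - s * h5
  refine ⟨T x w w x, fun y ↦ ?_⟩
  have hz : g x (y - g x y • w) = 0 := by simp [hw]
  have hy := hT.quadratic x (y - g x y • w) w 1 (g x y)
  rw [one_smul, sub_add_cancel] at hy
  rw [hy, h0 x _ hx hz, h2 _ hz]
  ring

include hs hd hV hT h0 in
/-- A curvature-like tensor that vanishes on degenerate planes has constant sectional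
curvature. -/
theorem IsCurvatureLike.exists_eq_mul_gram (hi : (∃ v, 0 < g v v) ∧ ∃ v, g v v < 0) :
    ∃ c : ℝ, ∀ x y, T x y y x = c * gram g x y := by
  have hnull : ∃ c : ℝ, ∀ x, g x x = 0 → ∀ y, T x y y x = c * g x y ^ 2 := by
    by_cases hex : ∃ x₀, x₀ ≠ 0 ∧ g x₀ x₀ = 0
    · obtain ⟨x₀, hx₀, hxx₀⟩ := hex
      obtain ⟨c, hc⟩ := hT.exists_eq_mul_sq hs hd hV h0 hxx₀
      refine ⟨c, fun x hx y ↦ ?_⟩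
      obtain rfl | hxn := eq_or_ne x 0
      · simpa using hT.smul_first 0 0 y y 0
      -- The null vector z links the constants of x₀ and x, because T x z z x = T z x x z.
      obtain ⟨z, hz, hz1, hz2⟩ := exists_null_nonorthogonal hs hd hV hi hx₀ hxn
      obtain ⟨c₁, hc₁⟩ := hT.exists_eq_mul_sq hs hd hV h0 hx
      obtain ⟨c₂, hc₂⟩ := hT.exists_eq_mul_sq hs hd hV h0 hz
      have e1 : c = c₂ := by
        apply mul_right_cancel₀ (pow_ne_zero 2 hz1)
        rw [← hc, hT.symm, hc₂, hs]
      have e2 : c₁ = c₂ := by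
        apply mul_right_cancel₀ (pow_ne_zero 2 hz2)
        rw [← hc₁, hT.symm, hc₂, hs]
      rw [hc₁, e1, e2]
    · refine ⟨0, fun x hx y ↦ ?_⟩
      have : x = 0 := by by_contra h; exact hex ⟨x, h, hx⟩
      subst this
      simpa using hT.smul_first 0 0 y y 0
  obtain ⟨c, hc⟩ := hnull
  have hnull' (x : V) (hx : g x x = 0) (y : V) : T x y y x = -c * gram g x y := by
    rw [hc x hx, gram, hx]; ring
  refine ⟨-c, fun x y ↦ ?_⟩
  by_cases hx : g x x = 0
  · exact hnull' x hx y
  -- For a fixed nonnull x the difference of both sides is a quadratic form in y vanishing on the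
  -- null cone, hence equal to μg; putting y = x gives μ = 0.
  obtain ⟨μ, hμ⟩ := exists_eq_mul_of_vanish_on_null hs hi
    (fun y ↦ T x y y x + c * gram g x y)
    (fun a b ↦ ⟨(T x a b x + T x b a x) + c * (2 * (g x x * g a b - g x a * g x b)), fun s t ↦ by
      simp only [hT.quadratic, gram]
      simp only [map_add, map_smul, add_apply,
          smul_apply, smul_eq_mul, hs b a]
      ring⟩)
    (fun y hy ↦ by
      have : gram g x y = gram g y x := by simp only [gram, hs x y]; ring
      rw [hT.symm, hnull' y hy x, this]; ring)
  have h1 := hμ x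
  have hμ0 : μ = 0 := by
    have h2 : gram g x x = 0 := by simp only [gram]; ring
    rw [hT.self_left, h2] at h1
    simpa [hx] using h1.symm
  have h2 := hμ y
  rw [hμ0] at h2
  linarith

end Constant

include hs hd hV in
/-- If the planes that are degenerate for `g` are degenerate for `h`, then `h` is a multiple
of `g`. -/
theorem exists_eq_mul_of_gram_eq_zero (hi : (∃ v, 0 < g v v) ∧ ∃ v, g v v < 0)
    {h : V →L[ℝ] V →L[ℝ] ℝ} (hsh : ∀ v w, h v w = h w v) (hdh : ∀ v, (∀ w, h v w = 0) → v = 0)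
    (h0 : ∀ x y, g x x = 0 → g x y = 0 → gram h x y = 0) :
    ∃ μ : ℝ, ∀ v w, h v w = μ * g v w := by
  obtain ⟨c, hc⟩ := (isCurvatureLike_gram h).exists_eq_mul_gram hs hd hV
    (fun x y hx hxy ↦ by simpa [gram, hsh y x, sq] using h0 x y hx hxy) hi
  obtain ⟨μ, hμ⟩ := exists_eq_mul_of_vanish_on_null hs hi (fun v ↦ h v v)
    (fun a b ↦ ⟨2 * h a b, fun s t ↦ by
      simp only [map_add, map_smul, add_apply,
          smul_apply, smul_eq_mul, hsh b a]
      ring⟩)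
    (fun x hx ↦ by
      -- If x is null and h(x,x) ≠ 0, polarizing the relation of Gram determinants gives
      -- h(x,x)h(z,w) = 0 for all w, so z lies in the kernel of h.
      by_contra hxx
      obtain ⟨z, hz0, hz1, hz2⟩ := exists_ne_zero_of_two_functionals hV (g x) (h x)
      refine hz0 (hdh z fun w ↦ ?_)
      have e1 := hc x w
      have e2 := hc x z
      have e3 := hc x (z + w)
      simp only [gram, map_add, add_apply, hz1, hz2, hx, hsh w z, hsh w x,
        hsh z x, hs w z] at e1 e2 e3
      have : h x x * h z w = 0 := by linear_combination (e3 - e1 - e2) / 2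
      exact (mul_eq_zero.1 this).resolve_left hxx)
  refine ⟨μ, fun v w ↦ ?_⟩
  have e1 := hμ v
  have e2 := hμ w
  have e3 := hμ (v + w)
  simp only [map_add, add_apply, hsh w v, hs w v] at e1 e2 e3
  linarith

/-! ### Separating the two factors by analyticity. -/

section Dichotomy

/-- On the line through a and b, two analytic functions with zero product cannot both be nontrivial.
-/
theorem ContDiff.exists_mul_ne_zero {W : Type*} [NormedAddCommGroup W] [NormedSpace ℝ W]
    {f₁ f₂ : W → ℝ} (h₁ : ContDiff ℝ ω f₁) (h₂ : ContDiff ℝ ω f₂) {a b : W}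
    (ha : f₁ a ≠ 0) (hb : f₂ b ≠ 0) : ∃ c, f₁ c * f₂ c ≠ 0 := by
  by_contra! h
  have hl : ContDiff ℝ ω (fun t : ℝ ↦ a + t • (b - a)) := by fun_prop
  rcases AnalyticOnNhd.eq_zero_or_eq_zero_of_mul_eq_zero
    (contDiff_omega_iff_analyticOnNhd.1 (h₁.comp hl))
    (contDiff_omega_iff_analyticOnNhd.1 (h₂.comp hl))
    (fun t _ ↦ h (a + t • (b - a))) isPreconnected_univ with h' | h'
  · exact ha (by simpa using h' 0 (mem_univ _))
  · exact hb (by simpa using h' 1 (mem_univ _))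

/-- For a null vector `e` this is a null vector; up to a factor it is the second point of the
null cone on the line through `e` and `v`. -/
def nullPoint (g : V →L[ℝ] V →L[ℝ] ℝ) (e v : V) : V := g v v • e - (2 * g e v) • v

include hs in
theorem nullPoint_null {e : V} (he : g e e = 0) (v : V) :
    g (nullPoint g e v) (nullPoint g e v) = 0 := by
  simp only [nullPoint, map_sub, map_smul, sub_apply, smul_apply, smul_eq_mul, he, hs v e]
  ring

/-- A single step from e gives -2g(e,x)x, which is lost when x is orthogonal to e. Passing through a
null z orthogonal to neither e nor x reaches every null direction. -/
theorem nullPoint_nullPoint {e z x : V} (hz : g z z = 0) (hx : g x x = 0) :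
    nullPoint g (nullPoint g e z) x = (4 * g e z * g z x) • x := by
  simp only [nullPoint, map_sub, map_smul, sub_apply, smul_apply, smul_eq_mul, hz, hx]
  module

include hs hd hV in
theorem constant_curvature_or_proportional (hi : (∃ v, 0 < g v v) ∧ ∃ v, g v v < 0)
    {h : V →L[ℝ] V →L[ℝ] ℝ} (hsh : ∀ v w, h v w = h w v) (hdh : ∀ v, (∀ w, h v w = 0) → v = 0)
    {T : V → V → V → V → ℝ} (hT : IsCurvatureLike T)
    (hTa : ContDiff ℝ ω (fun q : V × V ↦ T q.1 q.2 q.2 q.1))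
    (hprod : ∀ x y, x ≠ 0 → g x x = 0 → g x y = 0 → g y y ≠ 0 → T x y y x * gram h x y = 0) :
    (∃ c : ℝ, ∀ x y, T x y y x = c * gram g x y) ∨ ∃ μ : ℝ, ∀ v w, h v w = μ * g v w := by
  have hT0 (y : V) : T 0 y y 0 = 0 := by simpa using hT.smul_first 0 0 y y 0
  by_cases h1 : ∀ x y, g x x = 0 → g x y = 0 → T x y y x = 0
  · exact .inl (hT.exists_eq_mul_gram hs hd hV h1 hi)
  by_cases h2 : ∀ x y, g x x = 0 → g x y = 0 → gram h x y = 0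
  · exact .inr (exists_eq_mul_of_gram_eq_zero hs hd hV hi hsh hdh h2)
  exfalso
  push Not at h1 h2
  obtain ⟨x₁, y₁, hx₁, hxy₁, hT₁⟩ := h1
  obtain ⟨x₂, y₂, hx₂, hxy₂, hh₂⟩ := h2
  have hx₁0 : x₁ ≠ 0 := by rintro rfl; exact hT₁ (hT0 y₁)
  have hx₂0 : x₂ ≠ 0 := by rintro rfl; simp [gram] at hh₂
  obtain ⟨y₃, hxy₃, hy₃⟩ := exists_orthogonal_nonnull hs hd hV x₁
  -- A polynomial parametrization of the pairs (x,y) with x null and y orthogonal to x; `hsurj`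
  -- shows that it meets each such pair with x ≠ 0 up to a common nonzero factor.
  let X (q : V × V × V × V) : V := nullPoint g (nullPoint g x₁ q.1) q.2.1
  let Y (q : V × V × V × V) : V := g (X q) q.2.2.1 • q.2.2.2 - g (X q) q.2.2.2 • q.2.2.1
  have hXa : ContDiff ℝ ω X := by
    unfold X nullPoint
    fun_prop
  have hYa : ContDiff ℝ ω Y := by
    unfold Y
    fun_prop
  have hXn (q) : g (X q) (X q) = 0 := nullPoint_null hs (nullPoint_null hs hx₁ _) _
  have hXY (q) : g (X q) (Y q) = 0 := by
    simp only [Y, map_sub, map_smul, smul_eq_mul]; ring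
  have hsurj (x y : V) (hx0 : x ≠ 0) (hx : g x x = 0) (hxy : g x y = 0) :
      ∃ q, ∃ r : ℝ, r ≠ 0 ∧ X q = r • x ∧ Y q = r • y := by
    obtain ⟨z, hz, hz1, hz2⟩ := exists_null_nonorthogonal hs hd hV hi hx₁0 hx0
    obtain ⟨a, ha⟩ := exists_apply_eq_one hd hx0
    have hX : X (z, x, a, y) = (4 * g x₁ z * g z x) • x := nullPoint_nullPoint hz hx
    refine ⟨(z, x, a, y), 4 * g x₁ z * g z x, ?_, hX, ?_⟩
    · rw [hs z x]; positivity
    · simp only [Y, hX, map_smul, smul_apply, smul_eq_mul, ha, hxy]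
      simp
  have hF₁ : ContDiff ℝ ω (fun q ↦ T (X q) (Y q) (Y q) (X q)) :=
    hTa.comp (hXa.prodMk hYa)
  have hF₂ : ContDiff ℝ ω (fun q ↦ gram h (X q) (Y q)) := by
    unfold gram
    fun_prop
  have hF₃ : ContDiff ℝ ω (fun q ↦ g (Y q) (Y q)) := by fun_prop
  obtain ⟨q₁, r₁, hr₁, hX₁, hY₁⟩ := hsurj x₁ y₁ hx₁0 hx₁ hxy₁
  obtain ⟨q₂, r₂, hr₂, hX₂, hY₂⟩ := hsurj x₂ y₂ hx₂0 hx₂ hxy₂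
  obtain ⟨q₃, r₃, hr₃, hX₃, hY₃⟩ := hsurj x₁ y₃ hx₁0 hx₁ hxy₃
  obtain ⟨c, hc⟩ := hF₁.exists_mul_ne_zero hF₂ (a := q₁) (b := q₂)
    (by
      simp only [hX₁, hY₁, hT.smul_first, hT.smul_second, hT.smul_third, hT.smul_fourth]
      positivity)
    (by
      have : gram h (r₂ • x₂) (r₂ • y₂) = r₂ ^ 4 * gram h x₂ y₂ := by
        simp only [gram, map_smul, smul_apply, smul_eq_mul]; ring
      simp only [hX₂, hY₂, this]
      positivity)
  -- The third factor g(Y,Y) makes y nonnull, as `hprod` requires.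
  obtain ⟨d, hd'⟩ := (hF₁.mul hF₂).exists_mul_ne_zero hF₃ (a := c) (b := q₃) hc
    (by
      simp only [hY₃, map_smul, smul_apply, smul_eq_mul]
      positivity)
  simp only [ne_eq, mul_eq_zero, not_or] at hd'
  refine mul_ne_zero hd'.1.1 hd'.1.2 (hprod _ _ ?_ (hXn d) (hXY d) hd'.2)
  intro h
  exact hd'.1.1 (by rw [h, hT0])

end Dichotomy

end Forms

/-! ### Curvature in coordinates -/


section Coordinates

variable {V : Type*} [NormedAddCommGroup V] [NormedSpace ℝ V]

/-- The Christoffel symbols of the first kind of a field `c` of bilinear forms. -/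
def christoffelForm (c : V → V →L[ℝ] V →L[ℝ] ℝ) (z : V) : V →L[ℝ] V →L[ℝ] V →L[ℝ] ℝ :=
  (1 / 2 : ℝ) • (fderiv ℝ c z + (fderiv ℝ c z).flip
    - ((ContinuousLinearMap.flipₗᵢ ℝ V V ℝ).toContinuousLinearEquiv :
      (V →L[ℝ] V →L[ℝ] ℝ) →L[ℝ] V →L[ℝ] V →L[ℝ] ℝ) ∘L (fderiv ℝ c z).flip)

theorem christoffelForm_apply (c : V → V →L[ℝ] V →L[ℝ] ℝ) (z u v w : V) :
    christoffelForm c z u v w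
      = (1 / 2) * (fderiv ℝ c z u v w + fderiv ℝ c z v u w - fderiv ℝ c z w u v) := by
  simp [christoffelForm]

/-- The Christoffel symbols of the second kind of a field `c` of bilinear forms. -/
def christoffelMap (c : V → V →L[ℝ] V →L[ℝ] ℝ) (z : V) : V →L[ℝ] V →L[ℝ] V :=
  (ContinuousLinearMap.compL ℝ V (V →L[ℝ] ℝ) V (c z).inverse) ∘L christoffelForm c z

theorem christoffelMap_apply (c : V → V →L[ℝ] V →L[ℝ] ℝ) (z u v : V) :
    christoffelMap c z u v = (c z).inverse (christoffelForm c z u v) := rfl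

/-- The curvature operator of a field `c` of bilinear forms. -/
def curvatureMap (c : V → V →L[ℝ] V →L[ℝ] ℝ) (y u v w : V) : V :=
  fderiv ℝ (christoffelMap c) y u v w - fderiv ℝ (christoffelMap c) y v u w
    + christoffelMap c y u (christoffelMap c y v w)
    - christoffelMap c y v (christoffelMap c y u w)

variable {c : V → V →L[ℝ] V →L[ℝ] ℝ} {y : V}

set_option synthInstance.maxHeartbeats 200000 in
theorem contDiffAt_christoffelForm (hc : ContDiffAt ℝ ∞ c y) :
    ContDiffAt ℝ ∞ (christoffelForm c) y := by
  have hD : ContDiffAt ℝ ∞ (fderiv ℝ c) y := hc.fderiv_right (by simp)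
  have hF : ContDiffAt ℝ ∞ (fun z ↦ (fderiv ℝ c z).flip) y :=
    (ContinuousLinearMap.flipₗᵢ ℝ V V (V →L[ℝ] ℝ)).contDiff.contDiffAt.comp y hD
  exact ((hD.add hF).sub (contDiffAt_const.clm_comp hF)).const_smul _

theorem contDiffAt_christoffelMap [CompleteSpace V] (hc : ContDiffAt ℝ ∞ c y)
    (hinv : (c y).IsInvertible) : ContDiffAt ℝ ∞ (christoffelMap c) y := by
  have h1 : ContDiffAt ℝ ∞ (fun z ↦ (c z).inverse) y :=
    (ContinuousLinearMap.IsInvertible.contDiffAt_map_inverse hinv).comp y hc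
  exact ((ContinuousLinearMap.compL ℝ V (V →L[ℝ] ℝ) V).contDiff.contDiffAt.comp y h1).clm_comp
    (contDiffAt_christoffelForm hc)

theorem apply_christoffelMap (hinv : (c y).IsInvertible) (u v : V) :
    c y (christoffelMap c y u v) = christoffelForm c y u v := by
  rw [christoffelMap_apply]
  exact hinv.self_apply_inverse _

theorem fderiv_apply_symm (hs : ∀ z v w, c z v w = c z w v) (hc : DifferentiableAt ℝ c y)
    (u v w : V) : fderiv ℝ c y u v w = fderiv ℝ c y u w v := by
  have h (v w : V) : HasFDerivAt (fun z ↦ c z v w)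
      (((fderiv ℝ c y).flip v).flip w) y := by
    have := (hc.hasFDerivAt.clm_apply (hasFDerivAt_const v y)).clm_apply (hasFDerivAt_const w y)
    refine this.congr_fderiv ?_
    ext; simp
  have h1 := h v w
  simp only [hs _ v w] at h1
  exact DFunLike.congr_fun (h1.unique (h w v)) u

/-- Differentiate c(Γ(v,w),w) = ½ ∂_v c(w,w), which holds near y, in the direction u and
skew-symmetrize in u, v. The second derivatives cancel, and metric compatibility turns the
derivatives of c into the terms quadratic in Γ. -/
theorem apply_curvatureMap_self [CompleteSpace V] (hs : ∀ z v w, c z v w = c z w v)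
    (hc : ContDiffAt ℝ ∞ c y) (hinv : (c y).IsInvertible) (u v w : V) :
    c y (curvatureMap c y u v w) w = 0 := by
  have hcd : DifferentiableAt ℝ c y := hc.differentiableAt (by simp)
  have hD : DifferentiableAt ℝ (fderiv ℝ c) y :=
    (hc.fderiv_right (m := ∞) (by simp)).differentiableAt (by simp)
  have hΓ : DifferentiableAt ℝ (christoffelMap c) y :=
    (contDiffAt_christoffelMap hc hinv).differentiableAt (by simp)
  have hnear : ∀ᶠ z in 𝓝 y, DifferentiableAt ℝ c z ∧ (c z).IsInvertible := by
    refine ((hc.of_le (m := 1) (by simp)).eventually (by simp)).mono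
      (fun z hz ↦ hz.differentiableAt (by simp)) |>.and ?_
    obtain ⟨e, he⟩ := hinv
    filter_upwards [hc.continuousAt.preimage_mem_nhds (he ▸ e.nhds)] with z hz
    exact hz
  have hcompat (u a b : V) : fderiv ℝ c y u a b
      = c y (christoffelMap c y u a) b + c y (christoffelMap c y u b) a := by
    rw [apply_christoffelMap hinv, apply_christoffelMap hinv, christoffelForm_apply,
      christoffelForm_apply, fderiv_apply_symm hs hcd u b a, fderiv_apply_symm hs hcd a u b,
      fderiv_apply_symm hs hcd b u a]
    ring
  have hderiv (u v : V) : fderiv ℝ c y u (christoffelMap c y v w) w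
      + c y (fderiv ℝ (christoffelMap c) y u v w) w
      = (1 / 2) * fderiv ℝ (fderiv ℝ c) y u v w w := by
    have h1 := (hcd.hasFDerivAt.clm_apply ((hΓ.hasFDerivAt.clm_apply
      (hasFDerivAt_const v y)).clm_apply (hasFDerivAt_const w y))).clm_apply (hasFDerivAt_const w y)
    have h2 := (((hD.hasFDerivAt.clm_apply (hasFDerivAt_const v y)).clm_apply
      (hasFDerivAt_const w y)).clm_apply (hasFDerivAt_const w y)).const_mul (1 / 2 : ℝ)
    have h3 := h2.congr_of_eventuallyEq (f₁ := fun z ↦ c z (christoffelMap c z v w) w) (by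
      filter_upwards [hnear] with z hz
      rw [apply_christoffelMap hz.2, christoffelForm_apply, fderiv_apply_symm hs hz.1 w v w]
      ring)
    simpa [add_comm] using DFunLike.congr_fun (h1.unique h3) u
  have hsymm : fderiv ℝ (fderiv ℝ c) y u v = fderiv ℝ (fderiv ℝ c) y v u :=
    (hc.isSymmSndFDerivAt (by
      rw [minSmoothness_of_isRCLikeNormedField]
      exact WithTop.coe_le_coe.2 (le_top (a := (2 : ℕ∞))))).eq u v
  have e1 := hderiv u v
  have e2 := hderiv v u
  rw [hcompat] at e1 e2
  rw [hsymm] at e1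
  simp only [curvatureMap, map_add, map_sub, add_apply, sub_apply]
  have := hs y (christoffelMap c y v w) (christoffelMap c y u w)
  linarith

theorem isCurvatureLike_curvatureMap [CompleteSpace V] (hs : ∀ z v w, c z v w = c z w v)
    (hc : ContDiffAt ℝ ∞ c y) (hinv : (c y).IsInvertible) :
    IsCurvatureLike fun u v w a ↦ c y (curvatureMap c y u v w) a where
  add_first u u' v w a := by
    simp only [curvatureMap, map_add, map_sub, add_apply, sub_apply]; ring
  smul_first t u v w a := by
    simp only [curvatureMap, map_add, map_sub, add_apply, sub_apply, map_smul, smul_apply,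
      smul_eq_mul]; ring
  add_third u v w w' a := by
    simp only [curvatureMap, map_add, map_sub, add_apply, sub_apply]; ring
  smul_third t u v w a := by
    simp only [curvatureMap, map_add, map_sub, add_apply, sub_apply, map_smul, smul_apply,
      smul_eq_mul]; ring
  swap_left u v w a := by
    simp only [curvatureMap, map_add, map_sub, add_apply, sub_apply]; ring
  swap_right u v w a := by
    have h := apply_curvatureMap_self hs hc hinv u v
    have h1 := h w
    have h2 := h a
    have h3 := h (w + a)
    simp only [curvatureMap, map_add, map_sub, add_apply, sub_apply] at h1 h2 h3 ⊢
    linarith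

/-- At a fixed point the curvature is polynomial in the vectors, hence analytic even though the
metric is only smooth. -/
theorem contDiff_curvatureMap (b : V →L[ℝ] V →L[ℝ] ℝ) :
    ContDiff ℝ ω fun q : V × V ↦ b (curvatureMap c y q.1 q.2 q.2) q.1 := by
  unfold curvatureMap
  fun_prop

end Coordinates

/-! ### The metric and its curvature in the preferred chart. -/

namespace PseudoRiemannianMetric

variable {n : ℕ} {M : Type*} [TopologicalSpace M] [ChartedSpace (EuclideanSpace ℝ (Fin n)) M]
  [IsManifold (𝓡 n) ∞ M] (g : PseudoRiemannianMetric n M)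

local notation "𝔼" => EuclideanSpace ℝ (Fin n)

/-- Stated for a general F so as to apply both to an inverse chart and to its composition with `f`.
-/
theorem contDiffAt_val_mfderiv {F : 𝔼 → M} {y : 𝔼}
    (hF : ContMDiffAt 𝓘(ℝ, 𝔼) (𝓡 n) ∞ F y) (v w : 𝔼) :
    ContDiffAt ℝ ∞ (fun z ↦ g.val (F z) (mfderiv 𝓘(ℝ, 𝔼) (𝓡 n) F z v)
      (mfderiv 𝓘(ℝ, 𝔼) (𝓡 n) F z w)) y := by
  have : IsManifold (𝓡 n) 1 M := IsManifold.of_le (n := ∞) (by simp)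
  have hv (v : 𝔼) : ContMDiffAt 𝓘(ℝ, 𝔼) ((𝓡 n).prod 𝓘(ℝ, 𝔼)) ∞
      (fun z ↦ TotalSpace.mk' 𝔼 (E := TangentSpace (𝓡 n) (M := M)) (F z)
        (mfderiv 𝓘(ℝ, 𝔼) (𝓡 n) F z v)) y := by
    refine ContMDiffAt.clm_apply_of_inCoordinates (E₁ := TangentSpace 𝓘(ℝ, 𝔼) (M := 𝔼))
      (IB₁ := 𝓘(ℝ, 𝔼)) (IB₂ := 𝓡 n)
      (b₁ := id) (b₂ := F) (v := fun _ ↦ v) (ϕ := fun z ↦ mfderiv 𝓘(ℝ, 𝔼) (𝓡 n) F z)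
      (hF.mfderiv_const (by simp)) ?_ hF
    rw [contMDiffAt_totalSpace]
    exact ⟨contMDiffAt_id, by simpa using contMDiffAt_const⟩
  have hg : ContMDiffAt 𝓘(ℝ, 𝔼) ((𝓡 n).prod 𝓘(ℝ, 𝔼 →L[ℝ] 𝔼 →L[ℝ] ℝ)) ∞
      (fun z ↦ TotalSpace.mk' (𝔼 →L[ℝ] 𝔼 →L[ℝ] ℝ)
        (E := fun p ↦ TangentSpace (𝓡 n) p →L[ℝ] TangentSpace (𝓡 n) p →L[ℝ] ℝ)
        (F z) (g.val (F z))) y := (g.contMDiff (F y)).comp y hF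
  have := ContMDiffAt.clm_bundle_apply₂ (F₃ := ℝ) (E₃ := Bundle.Trivial M ℝ) hg (hv v) (hv w)
  rw [contMDiffAt_totalSpace] at this
  exact this.2.contDiffAt

theorem contDiffAt_clm_of_apply {F : Type*} [NormedAddCommGroup F] [NormedSpace ℝ F]
    {D G : Type*} [NormedAddCommGroup D] [NormedSpace ℝ D]  [NormedAddCommGroup G]
    [NormedSpace ℝ G] [FiniteDimensional ℝ D] {f : F → D →L[ℝ] G} {x : F} {m : WithTop ℕ∞}
    (h : ∀ v, ContDiffAt ℝ m (fun y ↦ f y v) x) : ContDiffAt ℝ m f x := by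
  let d := Module.finrank ℝ D
  have hd : d = Module.finrank ℝ (Fin d → ℝ) := (Module.finrank_fin_fun ℝ).symm
  let e₁ := ContinuousLinearEquiv.ofFinrankEq hd
  let e₂ := (e₁.arrowCongr (1 : G ≃L[ℝ] G)).trans (ContinuousLinearEquiv.piRing (Fin d))
  rw [← Function.id_comp f, ← e₂.symm_comp_self]
  exact e₂.symm.contDiff.contDiffAt.comp x (contDiffAt_pi.mpr fun i ↦ h _)

theorem extChartAt_symm_contMDiffAt (p : M) {y : 𝔼}
    (hy : y ∈ (extChartAt (𝓡 n) p).target) :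
    ContMDiffAt 𝓘(ℝ, 𝔼) (𝓡 n) ∞ (extChartAt (𝓡 n) p).symm y :=
  (contMDiffOn_extChartAt_symm p).contMDiffAt
    ((isOpen_extChartAt_target p).mem_nhds hy)

theorem coord_apply (p : M) (y v w : 𝔼) :
    g.coord p y v w = g.val ((extChartAt (𝓡 n) p).symm y)
      (mfderiv 𝓘(ℝ, 𝔼) (𝓡 n) (extChartAt (𝓡 n) p).symm y v)
      (mfderiv 𝓘(ℝ, 𝔼) (𝓡 n) (extChartAt (𝓡 n) p).symm y w) := rfl

theorem contDiffAt_coord (p : M) {y : 𝔼}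
    (hy : y ∈ (extChartAt (𝓡 n) p).target) : ContDiffAt ℝ ∞ (g.coord p) y :=
  contDiffAt_clm_of_apply fun v ↦ contDiffAt_clm_of_apply fun w ↦
    g.contDiffAt_val_mfderiv (extChartAt_symm_contMDiffAt p hy) v w

theorem coord_symm (p : M) (y v w : 𝔼) :
    g.coord p y v w = g.coord p y w v := g.symm _ _ _

/-- The tangent space at p is the model space by means of the preferred chart at p, in which the
inverse chart reads as the identity. -/
theorem mfderiv_extChartAt_symm_self (p : M) :
    (mfderiv 𝓘(ℝ, 𝔼) (𝓡 n) (extChartAt (𝓡 n) p).symm (extChartAt (𝓡 n) p p) : 𝔼 →L[ℝ] 𝔼)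
      = ContinuousLinearMap.id ℝ 𝔼 := by
  have hy : extChartAt (𝓡 n) p p ∈ (extChartAt (𝓡 n) p).target := mem_extChartAt_target p
  have hc := (extChartAt_symm_contMDiffAt p hy).continuousAt
  refine HasMFDerivAt.mfderiv ⟨hc, ?_⟩
  have hw : writtenInExtChartAt 𝓘(ℝ, 𝔼) (𝓡 n) (extChartAt (𝓡 n) p p) (extChartAt (𝓡 n) p).symm
      =ᶠ[𝓝 (extChartAt (𝓡 n) p p)] id := by
    filter_upwards [(isOpen_extChartAt_target p).mem_nhds hy] with z hz
    simp only [writtenInExtChartAt, extChartAt_to_inv, Function.comp_apply,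
      extChartAt_model_space_eq_id]
    exact (extChartAt (𝓡 n) p).right_inv hz
  exact ((hasFDerivAt_id _).congr_of_eventuallyEq hw).hasFDerivWithinAt

theorem coord_self (p : M) :
    g.coord p (extChartAt (𝓡 n) p p) = (g.val p : 𝔼 →L[ℝ] 𝔼 →L[ℝ] ℝ) := by
  ext v w
  have hval {q : M} (hq : q = p) : (g.val q : 𝔼 →L[ℝ] 𝔼 →L[ℝ] ℝ) = g.val p := by
    subst hq; rfl
  have h := hval (extChartAt_to_inv (I := 𝓡 n) p)
  rw [coord_apply, mfderiv_extChartAt_symm_self]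
  exact DFunLike.congr_fun (DFunLike.congr_fun h v) w

theorem isInvertible_of_nondegenerate {V : Type*} [NormedAddCommGroup V] [NormedSpace ℝ V]
    [FiniteDimensional ℝ V] {b : V →L[ℝ] V →L[ℝ] ℝ} (hb : ∀ v, (∀ w, b v w = 0) → v = 0) :
    b.IsInvertible := by
  have hinj : Function.Injective (b : V →ₗ[ℝ] V →L[ℝ] ℝ) := by
    rw [injective_iff_map_eq_zero]
    intro v hv
    exact hb v fun w ↦ DFunLike.congr_fun hv w
  have hdim : Module.finrank ℝ V = Module.finrank ℝ (V →L[ℝ] ℝ) := by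
    rw [← LinearMap.toContinuousLinearMap.finrank_eq]
    exact Subspace.dual_finrank_eq.symm
  exact ⟨(LinearEquiv.ofInjectiveOfFinrankEq _ hinj hdim).toContinuousLinearEquiv, by ext; rfl⟩

theorem curvature_eq (p : M) (u v w a : 𝔼) :
    g.curvature p u v w a = g.coord p (extChartAt (𝓡 n) p p)
      (curvatureMap (g.coord p) (extChartAt (𝓡 n) p p) u v w) a := by
  have hinv : (g.coord p (extChartAt (𝓡 n) p p)).IsInvertible := by
    rw [coord_self]
    exact isInvertible_of_nondegenerate (g.nondegenerate p)
  have hc := g.contDiffAt_coord p (mem_extChartAt_target p)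
  have hΓ := (contDiffAt_christoffelMap hc hinv).differentiableAt (by simp)
  have hchr (z u v : 𝔼) : g.christoffel p z u v = christoffelMap (g.coord p) z u v := by
    rw [christoffelMap_apply]
    unfold christoffel
    congr 1
  have hd (v w u : 𝔼) : fderiv ℝ (fun z ↦ g.christoffel p z v w) (extChartAt (𝓡 n) p p) u
      = fderiv ℝ (christoffelMap (g.coord p)) (extChartAt (𝓡 n) p p) u v w := by
    simp only [hchr]
    have := (hΓ.hasFDerivAt.clm_apply (hasFDerivAt_const v _)).clm_apply (hasFDerivAt_const w _)
    simpa using DFunLike.congr_fun this.fderiv u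
  rw [coord_self]
  unfold curvature curvatureOperator
  have hop : ∀ r : 𝔼, r = curvatureMap (V := 𝔼) (g.coord p) (extChartAt (𝓡 n) p p) u v w →
      (g.val p : 𝔼 →L[ℝ] 𝔼 →L[ℝ] ℝ) r a = (g.val p : 𝔼 →L[ℝ] 𝔼 →L[ℝ] ℝ)
        (curvatureMap (V := 𝔼) (g.coord p) (extChartAt (𝓡 n) p p) u v w) a := by
    rintro r rfl; rfl
  refine hop _ ?_
  dsimp only
  rw [hd, hd]
  simp only [hchr, curvatureMap]

theorem isCurvatureLike_curvature (p : M) :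
    IsCurvatureLike (V := 𝔼) (g.curvature p) := by
  have hinv : (g.coord p (extChartAt (𝓡 n) p p)).IsInvertible := by
    rw [coord_self]
    exact isInvertible_of_nondegenerate (g.nondegenerate p)
  have h := isCurvatureLike_curvatureMap (g.coord_symm p)
    (g.contDiffAt_coord p (mem_extChartAt_target p)) hinv
  simpa only [← curvature_eq] using h

theorem contDiff_curvature (p : M) :
    ContDiff ℝ ω fun q : 𝔼 × 𝔼 ↦ g.curvature p q.1 q.2 q.2 q.1 := by
  have h := contDiff_curvatureMap (c := g.coord p) (y := extChartAt (𝓡 n) p p)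
    (g.coord p (extChartAt (𝓡 n) p p))
  simpa only [← curvature_eq] using h

end PseudoRiemannianMetric

/-! ### Planes -/

namespace Plane

variable {V : Type*} [AddCommGroup V] [Module ℝ V]

theorem subtype_comp_basis (α : Plane V) :
    α.1.subtype ∘ α.basis = ![(α.basis 0 : V), (α.basis 1 : V)] := by
  funext i
  fin_cases i <;> rfl

theorem basis_linearIndependent (α : Plane V) :
    LinearIndependent ℝ ![(α.basis 0 : V), (α.basis 1 : V)] := by
  rw [← subtype_comp_basis]
  exact α.basis.linearIndependent.map' α.1.subtype (Submodule.ker_subtype _)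

theorem span_basis (α : Plane V) :
    Plane.span ⟨![(α.basis 0 : V), (α.basis 1 : V)], α.basis_linearIndependent⟩ = α := by
  apply Subtype.ext
  have h := congrArg (Submodule.map α.1.subtype) α.basis.span_eq
  rw [Submodule.map_span, Submodule.map_subtype_top, ← Set.range_comp, subtype_comp_basis] at h
  exact h

theorem mem_span_iff {x y : V} (hxy : LinearIndependent ℝ ![x, y]) (w : V) :
    w ∈ (span ⟨_, hxy⟩).1 ↔ ∃ s t : ℝ, s • x + t • y = w := by
  change w ∈ Submodule.span ℝ (Set.range ![x, y]) ↔ _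
  rw [Matrix.range_cons, Matrix.range_cons, Matrix.range_empty, Set.union_empty,
    Set.singleton_union, Submodule.mem_span_pair]

/-- A curvature-like tensor changes by a nonzero square under a change of the basis of a plane. -/
theorem exists_basis_factor {x y : V} (hxy : LinearIndependent ℝ ![x, y]) :
    ∃ r : ℝ, r ≠ 0 ∧ ∀ T : V → V → V → V → ℝ, IsCurvatureLike T →
      T ((span ⟨_, hxy⟩).basis 0) ((span ⟨_, hxy⟩).basis 1) ((span ⟨_, hxy⟩).basis 1)
        ((span ⟨_, hxy⟩).basis 0) = r * T x y y x := by
  set α := span ⟨_, hxy⟩ with hα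
  have hmem (i : Fin 2) : ∃ a b : ℝ, a • x + b • y = (α.basis i : V) :=
    (mem_span_iff hxy _).1 (α.basis i).2
  obtain ⟨a, b, h0⟩ := hmem 0
  obtain ⟨c, d, h1⟩ := hmem 1
  refine ⟨(a * d - b * c) ^ 2, ?_, fun T hT ↦ ?_⟩
  · intro h
    have hdet : a * d - b * c = 0 := by simpa using h
    have hli := LinearIndependent.pair_iff.1 α.basis_linearIndependent
    have e1 := hli d (-b) (by
      rw [← h0, ← h1, show d • (a • x + b • y) + -b • (c • x + d • y) = (a * d - b * c) • x by module,
        hdet, zero_smul])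
    have e2 := hli (-c) a (by
      rw [← h0, ← h1, show -c • (a • x + b • y) + a • (c • x + d • y) = (a * d - b * c) • y by module,
        hdet, zero_smul])
    have h0' : (α.basis 0 : V) = 0 := by
      rw [← h0, e2.2, show b = 0 by linarith [e1.2]]; simp
    exact α.basis.ne_zero 0 (Subtype.ext h0')
  · rw [← h0, ← h1, hT.combination]

theorem map_span {W : Type*} [AddCommGroup W] [Module ℝ W] (e : V ≃ₗ[ℝ] W) {x y : V}
    (hxy : LinearIndependent ℝ ![x, y]) (hxy' : LinearIndependent ℝ ![e x, e y]) :
    (span ⟨_, hxy⟩).map e = span ⟨_, hxy'⟩ := by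
  apply Subtype.ext
  change Submodule.map (e : V →ₗ[ℝ] W) (Submodule.span ℝ _) = Submodule.span ℝ _
  rw [Submodule.map_span, ← Set.range_comp]
  congr 2
  ext i
  fin_cases i <;> rfl

theorem continuous_span [TopologicalSpace V] : Continuous (span (V := V)) :=
  continuous_coinduced_rng

end Plane

/-! ### The rank of a form on a plane, from its Gram matrix. -/

section Rank

variable {V : Type*} [AddCommGroup V] [Module ℝ V] (b : LinearMap.BilinForm ℝ V) {x y : V}
  (hxy : LinearIndependent ℝ ![x, y])

theorem mem_ker_restrict_span_iff (w : (Plane.span ⟨_, hxy⟩).1) :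
    w ∈ LinearMap.ker (b.restrict (Plane.span ⟨_, hxy⟩).1) ↔ b w x = 0 ∧ b w y = 0 := by
  rw [LinearMap.mem_ker]
  constructor
  · intro h
    exact ⟨DFunLike.congr_fun h ⟨x, (Plane.mem_span_iff hxy x).2 ⟨1, 0, by simp⟩⟩,
      DFunLike.congr_fun h ⟨y, (Plane.mem_span_iff hxy y).2 ⟨0, 1, by simp⟩⟩⟩
  · rintro ⟨hx, hy⟩
    ext ⟨v, hv⟩
    obtain ⟨s, t, rfl⟩ := (Plane.mem_span_iff hxy v).1 hv
    change b w (s • x + t • y) = 0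
    simp [hx, hy]

theorem finrank_range_add_finrank_ker_restrict_span :
    Module.finrank ℝ (LinearMap.range (b.restrict (Plane.span ⟨_, hxy⟩).1))
      + Module.finrank ℝ (LinearMap.ker (b.restrict (Plane.span ⟨_, hxy⟩).1)) = 2 := by
  have : Module.Finite ℝ (Plane.span ⟨_, hxy⟩).1 :=
    Module.finite_of_finrank_eq_succ (Plane.span ⟨_, hxy⟩).2
  rw [LinearMap.finrank_range_add_finrank_ker, (Plane.span ⟨_, hxy⟩).2]

theorem finrank_range_restrict_span_eq_two_iff (hs : ∀ v w, b v w = b w v) :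
    Module.finrank ℝ (LinearMap.range (b.restrict (Plane.span ⟨_, hxy⟩).1)) = 2
      ↔ b x x * b y y - b x y ^ 2 ≠ 0 := by
  have : Module.Finite ℝ (Plane.span ⟨_, hxy⟩).1 :=
    Module.finite_of_finrank_eq_succ (Plane.span ⟨_, hxy⟩).2
  have hsum := finrank_range_add_finrank_ker_restrict_span b hxy
  have hker : Module.finrank ℝ (LinearMap.range (b.restrict (Plane.span ⟨_, hxy⟩).1)) = 2
      ↔ LinearMap.ker (b.restrict (Plane.span ⟨_, hxy⟩).1) = ⊥ := by
    rw [← Submodule.finrank_eq_zero (R := ℝ)]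
    omega
  rw [hker, Submodule.eq_bot_iff]
  have hli := LinearIndependent.pair_iff.1 hxy
  constructor
  · intro h hdet
    have key (s t : ℝ) (h1 : s * b x x + t * b x y = 0) (h2 : s * b x y + t * b y y = 0) :
        s = 0 ∧ t = 0 := by
      apply hli
      have := h ⟨s • x + t • y, (Plane.mem_span_iff hxy _).2 ⟨s, t, rfl⟩⟩
        ((mem_ker_restrict_span_iff b hxy _).2 (by simpa [hs y x] using ⟨h1, h2⟩))
      simpa using this
    -- If the determinant is 0, the rows of the adjugate matrix lie in the kernel. A trivial kernel
    -- makes them zero, so the form vanishes on the plane and x itself lies in the kernel.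
    have h1 := key (b y y) (-b x y) (by linear_combination hdet) (by ring)
    have h2 := key (b x y) (-b x x) (by ring) (by linear_combination -hdet)
    have h3 := key 1 0 (by linarith [h2.2]) (by linarith [h2.1])
    exact one_ne_zero h3.1
  · rintro hdet ⟨w, hw⟩ hwk
    obtain ⟨s, t, rfl⟩ := (Plane.mem_span_iff hxy w).1 hw
    rw [mem_ker_restrict_span_iff] at hwk
    simp only [map_add, map_smul, LinearMap.add_apply, LinearMap.smul_apply, smul_eq_mul,
      hs y x] at hwk
    have h1 : (b x x * b y y - b x y ^ 2) * s = 0 := by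
      linear_combination b y y * hwk.1 - b x y * hwk.2
    have h2 : (b x x * b y y - b x y ^ 2) * t = 0 := by
      linear_combination b x x * hwk.2 - b x y * hwk.1
    ext
    simp [(mul_eq_zero.1 h1).resolve_left hdet, (mul_eq_zero.1 h2).resolve_left hdet]

theorem finrank_range_restrict_span_eq_one (hs : ∀ v w, b v w = b w v) (hx : b x x = 0)
    (h : b x y = 0) (hy : b y y ≠ 0) :
    Module.finrank ℝ (LinearMap.range (b.restrict (Plane.span ⟨_, hxy⟩).1)) = 1 := by
  have : Module.Finite ℝ (Plane.span ⟨_, hxy⟩).1 :=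
    Module.finite_of_finrank_eq_succ (Plane.span ⟨_, hxy⟩).2
  have hsum := finrank_range_add_finrank_ker_restrict_span b hxy
  have h2 : Module.finrank ℝ (LinearMap.range (b.restrict (Plane.span ⟨_, hxy⟩).1)) ≠ 2 := by
    rw [Ne, finrank_range_restrict_span_eq_two_iff b hxy hs]
    simp [hx, h]
  have h0 : Module.finrank ℝ (LinearMap.range (b.restrict (Plane.span ⟨_, hxy⟩).1)) ≠ 0 := by
    rw [Ne, Submodule.finrank_eq_zero, LinearMap.range_eq_bot]
    intro hb
    have hyk : (⟨y, (Plane.mem_span_iff hxy y).2 ⟨0, 1, by simp⟩⟩ : (Plane.span ⟨_, hxy⟩).1) ∈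
        LinearMap.ker (b.restrict (Plane.span ⟨_, hxy⟩).1) := by
      rw [hb, LinearMap.ker_zero]; exact Submodule.mem_top
    exact hy ((mem_ker_restrict_span_iff b hxy _).1 hyk).2
  omega

end Rank

/-! ### The conformal factor -/

namespace PseudoRiemannianMetric

variable {n : ℕ} {M : Type*} [TopologicalSpace M] [ChartedSpace (EuclideanSpace ℝ (Fin n)) M]
  [IsManifold (𝓡 n) ∞ M] (g : PseudoRiemannianMetric n M)
  {N : Type*} [TopologicalSpace N] [ChartedSpace (EuclideanSpace ℝ (Fin n)) N]
  [IsManifold (𝓡 n) ∞ N] (g' : PseudoRiemannianMetric n N) (f : M ≃ₘ^∞⟮𝓡 n, 𝓡 n⟯ N)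

local notation "𝔼" => EuclideanSpace ℝ (Fin n)

/-- The metric on a tangent space, as a bilinear form on the model space. -/
def form (p : M) : 𝔼 →L[ℝ] 𝔼 →L[ℝ] ℝ := g.val p

theorem form_symm (p : M) (v w : 𝔼) : g.form p v w = g.form p w v := g.symm p v w

theorem form_nondegenerate (p : M) (v : 𝔼) (h : ∀ w, g.form p v w = 0) : v = 0 :=
  g.nondegenerate p v h

/-- The differential of a diffeomorphism, as a linear automorphism of the model space. -/
def differential (p : M) : 𝔼 ≃L[ℝ] 𝔼 := f.mfderivToContinuousLinearEquiv (by simp) p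

/-- The pullback of a metric under a diffeomorphism, on the model space. -/
def pullbackForm (p : M) : 𝔼 →L[ℝ] 𝔼 →L[ℝ] ℝ :=
  (g'.form (f p)).bilinearComp (differential f p : 𝔼 →L[ℝ] 𝔼) (differential f p : 𝔼 →L[ℝ] 𝔼)

theorem pullbackForm_apply (p : M) (v w : 𝔼) : g'.pullbackForm f p v w
    = g'.form (f p) (differential f p v) (differential f p w) := rfl

theorem pullbackForm_symm (p : M) (v w : 𝔼) :
    g'.pullbackForm f p v w = g'.pullbackForm f p w v := g'.symm _ _ _

theorem pullbackForm_nondegenerate (p : M) (v : 𝔼) (h : ∀ w, g'.pullbackForm f p v w = 0) :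
    v = 0 := by
  have h1 : differential f p v = 0 := g'.form_nondegenerate (f p) _ fun w ↦ by
    have := h ((differential f p).symm w)
    rwa [pullbackForm_apply, ContinuousLinearEquiv.apply_symm_apply] at this
  simpa using h1

section Planes

variable {p : M} {x y : EuclideanSpace ℝ (Fin n)} (hxy : LinearIndependent ℝ ![x, y])

theorem isNondegeneratePlane_span_iff :
    g.IsNondegeneratePlane p (Plane.span (V := 𝔼) ⟨_, hxy⟩) ↔ gram (g.form p) x y ≠ 0 :=
  finrank_range_restrict_span_eq_two_iff (V := 𝔼) (g.form p).toBilinForm hxy (g.form_symm p)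

theorem isWeaklyDegeneratePlane_span (hx : g.form p x x = 0) (h : g.form p x y = 0)
    (hy : g.form p y y ≠ 0) : g.IsWeaklyDegeneratePlane p (Plane.span (V := 𝔼) ⟨_, hxy⟩) :=
  finrank_range_restrict_span_eq_one (V := 𝔼) (g.form p).toBilinForm hxy (g.form_symm p) hx h hy

theorem sectionalCurvature_span :
    g.sectionalCurvature p (Plane.span (V := 𝔼) ⟨_, hxy⟩)
      = g.curvature p x y y x / gram (g.form p) x y := by
  obtain ⟨r, hr, h⟩ := Plane.exists_basis_factor hxy
  have h1 := h _ (g.isCurvatureLike_curvature p)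
  have h2 := h _ (isCurvatureLike_gram (g.form p))
  have h3 : g.form p x x * g.form p y y - g.form p x y * g.form p y x = gram (g.form p) x y := by
    rw [gram, g.form_symm p y x]; ring
  beta_reduce at h2
  rw [h3] at h2
  rw [← mul_div_mul_left _ _ hr, ← h1, ← h2]
  rfl

theorem pushPlane_span
    (hxy' : LinearIndependent ℝ ![differential f p x, differential f p y]) :
    pushPlane f p (Plane.span (V := 𝔼) ⟨_, hxy⟩) = Plane.span (V := 𝔼) ⟨_, hxy'⟩ :=
  Plane.map_span (differential f p).toLinearEquiv hxy hxy'

end Planes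

theorem gram_pullbackForm (p : M) (x y : 𝔼) : gram (g'.pullbackForm f p) x y
    = gram (g'.form (f p)) (differential f p x) (differential f p y) := rfl

theorem isOfConstantCurvatureAt_of_eq_mul_gram {p : M} {c : ℝ}
    (h : ∀ x y : 𝔼, g.curvature p x y y x = c * gram (g.form p) x y) :
    g.IsOfConstantCurvatureAt p := by
  refine ⟨c, fun (α : Plane 𝔼) hα ↦ ?_⟩
  rw [← α.span_basis] at hα ⊢
  rw [isNondegeneratePlane_span_iff] at hα
  rw [sectionalCurvature_span, h, mul_div_cancel_right₀ _ hα]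

theorem continuous_curvature (p : M) {X : Type*} [TopologicalSpace X] {u v : X → 𝔼}
    (hu : Continuous u) (hv : Continuous v) :
    Continuous fun t ↦ g.curvature p (u t) (v t) (v t) (u t) := by
  have h := (g.contDiff_curvature p).continuous
  generalize g.curvature p = T at h ⊢
  exact h.comp (hu.prodMk hv)

/-- If both factors are nonzero, the curvature quotient along the planes spanned by x + tz and y is
a continuous function of t times the Gram determinant of g. It tends to 0, against the limit 1. -/
theorem curvature_mul_gram_eq_zero {p : M}
    (hf : ∀ α₀ : Plane (TangentSpace (𝓡 n) p), g.IsWeaklyDegeneratePlane p α₀ →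
      g.LimitCondition g' f p α₀) {x y : 𝔼} (hx0 : x ≠ 0) (hx : g.form p x x = 0)
    (hxy : g.form p x y = 0) (hy : g.form p y y ≠ 0) :
    g.curvature p x y y x * gram (g'.pullbackForm f p) x y = 0 := by
  by_contra hne
  obtain ⟨hk, hh⟩ := not_or.1 (mul_eq_zero.not.1 hne)
  -- With g(x,z) = 1 the Gram determinant of x + tz and y is 2g(y,y)t + O(t²), so these planes are
  -- nondegenerate for small t ≠ 0.
  obtain ⟨z, hz⟩ := exists_apply_eq_one (g := g.form p) (g.nondegenerate p) hx0
  have hy0 : y ≠ 0 := by rintro rfl; simp at hy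
  have hli (t : ℝ) : LinearIndependent ℝ ![x + t • z, y] := by
    rw [LinearIndependent.pair_iff]
    intro a b hab
    have ha : a = 0 := by
      by_cases ht : t = 0
      · have := congrArg (g.form p y) hab
        simp only [ht, zero_smul, add_zero, map_add, map_smul, g.form_symm p y x, hxy, smul_eq_mul,
          mul_zero, zero_add, map_zero] at this
        have hb : b = 0 := (mul_eq_zero.1 this).resolve_right hy
        simpa [ht, hb, hx0] using hab
      · have := congrArg (g.form p x) hab
        simp only [map_add, map_smul, hx, hxy, hz, smul_eq_mul, mul_zero, zero_add, add_zero,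
          map_zero, mul_one] at this
        exact (mul_eq_zero.1 this).resolve_right ht
    exact ⟨ha, by simpa [ha, hy0] using hab⟩
  have hli' (t : ℝ) : LinearIndependent ℝ ![differential f p (x + t • z), differential f p y] := by
    have := (hli t).map' (differential f p : 𝔼 →ₗ[ℝ] 𝔼)
      (LinearMap.ker_eq_bot.2 (differential f p).injective)
    rwa [show (differential f p : 𝔼 →ₗ[ℝ] 𝔼) ∘ ![x + t • z, y]
      = ![differential f p (x + t • z), differential f p y] by
        funext i; fin_cases i <;> rfl] at this
  let γ (t : ℝ) : Plane 𝔼 := Plane.span ⟨_, hli t⟩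
  have hcx : Continuous fun t : ℝ ↦ x + t • z := by fun_prop
  have hγ : Continuous γ := by
    refine Plane.continuous_span.comp (Continuous.subtype_mk (continuous_pi fun i ↦ ?_) _)
    fin_cases i
    · exact hcx
    · exact continuous_const
  have hγ0 : γ 0 = Plane.span ⟨![x, y], by simpa using hli 0⟩ := by simp [γ]
  have hlim : g.LimitCondition g' f p (γ 0) := by
    refine hf _ ?_
    rw [hγ0]
    exact g.isWeaklyDegeneratePlane_span _ hx hxy hy
  have hK (t : ℝ) : g.sectionalCurvature p (γ t)
      = g.curvature p (x + t • z) y y (x + t • z) / gram (g.form p) (x + t • z) y :=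
    g.sectionalCurvature_span (hli t)
  have hK' (t : ℝ) : g'.sectionalCurvature (f p) (pushPlane f p (γ t))
      = g'.curvature (f p) (differential f p (x + t • z)) (differential f p y)
          (differential f p y) (differential f p (x + t • z))
        / gram (g'.pullbackForm f p) (x + t • z) y := by
    rw [gram_pullbackForm, ← g'.sectionalCurvature_span (hli' t), ← pushPlane_span f (hli t)]
  have hck : Continuous fun t : ℝ ↦ g.curvature p (x + t • z) y y (x + t • z) :=
    g.continuous_curvature p hcx continuous_const
  have hck' : Continuous fun t : ℝ ↦ g'.curvature (f p) (differential f p (x + t • z))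
      (differential f p y) (differential f p y) (differential f p (x + t • z)) :=
    g'.continuous_curvature (f p) (by fun_prop) continuous_const
  have hch : Continuous fun t : ℝ ↦ gram (g'.pullbackForm f p) (x + t • z) y := by
    unfold gram; fun_prop
  have hcg : Continuous fun t : ℝ ↦ gram (g.form p) (x + t • z) y := by
    unfold gram; fun_prop
  have hev_k : ∀ᶠ t in 𝓝 (0 : ℝ), g.curvature p (x + t • z) y y (x + t • z) ≠ 0 :=
    hck.continuousAt.eventually_ne (by simpa using hk)
  have hev_h : ∀ᶠ t in 𝓝 (0 : ℝ), gram (g'.pullbackForm f p) (x + t • z) y ≠ 0 :=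
    hch.continuousAt.eventually_ne (by simpa using hh)
  have hev_g : ∀ᶠ t in 𝓝[≠] (0 : ℝ), gram (g.form p) (x + t • z) y ≠ 0 := by
    have hc : Continuous fun t : ℝ ↦ 2 * g.form p y y
        + t * (g.form p z z * g.form p y y - g.form p z y ^ 2) := by fun_prop
    have h1 := hc.continuousAt.eventually_ne (x := 0) (y := 0) (by simpa using hy)
    filter_upwards [h1.filter_mono nhdsWithin_le_nhds, self_mem_nhdsWithin] with t ht ht0
    have : gram (g.form p) (x + t • z) y = t * (2 * g.form p y y
        + t * (g.form p z z * g.form p y y - g.form p z y ^ 2)) := by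
      simp only [gram, map_add, map_smul, add_apply, smul_apply, smul_eq_mul, hx, hxy, hz,
        g.form_symm p z x]
      ring
    rw [this]
    exact mul_ne_zero ht0 ht
  have htend : Tendsto γ (𝓝[≠] 0) (𝓝[quotientDomain g g' f p] (γ 0)) := by
    refine tendsto_nhdsWithin_iff.2 ⟨hγ.continuousAt.tendsto.mono_left nhdsWithin_le_nhds, ?_⟩
    filter_upwards [hev_g, hev_k.filter_mono nhdsWithin_le_nhds,
      hev_h.filter_mono nhdsWithin_le_nhds] with t h1 h2 h3
    refine ⟨(g.isNondegeneratePlane_span_iff (hli t)).2 h1, ?_, ?_⟩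
    · have := (g'.isNondegeneratePlane_span_iff (p := f p) (hli' t)).2 h3
      rwa [← pushPlane_span f (hli t)] at this
    · rw [hK]
      exact div_ne_zero h2 h1
  have h1 := Tendsto.comp hlim htend
  have h2 : Tendsto (fun t ↦ g'.sectionalCurvature (f p) (pushPlane f p (γ t))
      / g.sectionalCurvature p (γ t)) (𝓝[≠] 0) (𝓝 0) := by
    simp only [hK, hK', div_div_eq_mul_div]
    have h3 : ContinuousAt (fun t : ℝ ↦
        g'.curvature (f p) (differential f p (x + t • z)) (differential f p y)
          (differential f p y) (differential f p (x + t • z))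
        / gram (g'.pullbackForm f p) (x + t • z) y * gram (g.form p) (x + t • z) y
        / g.curvature p (x + t • z) y y (x + t • z)) 0 :=
      ((hck'.continuousAt.div hch.continuousAt hev_h.self_of_nhds).mul hcg.continuousAt).div
        hck.continuousAt hev_k.self_of_nhds
    have h4 : gram (g.form p) x y = 0 := by simp [gram, hx, hxy]
    have h5 := h3.tendsto
    simp only [zero_smul, add_zero, h4, mul_zero, zero_div] at h5
    exact h5.mono_left nhdsWithin_le_nhds
  exact one_ne_zero (tendsto_nhds_unique h1 h2)

theorem exists_pullbackForm_eq_mul (hn : 3 ≤ n) (hg : g.IsIndefinite) {p : M}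
    (hf : ∀ α₀ : Plane (TangentSpace (𝓡 n) p), g.IsWeaklyDegeneratePlane p α₀ →
      g.LimitCondition g' f p α₀) (hp : ¬ g.IsOfConstantCurvatureAt p) :
    ∃ μ : ℝ, ∀ v w, g'.pullbackForm f p v w = μ * g.form p v w := by
  refine (constant_curvature_or_proportional (g.form_symm p) (g.nondegenerate p) (by simpa)
    (hg p) (g'.pullbackForm_symm f p) (g'.pullbackForm_nondegenerate f p)
    (g.isCurvatureLike_curvature p) (g.contDiff_curvature p)
    (fun x y hx0 hx hxy hy ↦ g.curvature_mul_gram_eq_zero g' f hf hx0 hx hxy hy)).resolve_left ?_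
  rintro ⟨c, hc⟩
  exact hp (g.isOfConstantCurvatureAt_of_eq_mul_gram hc)

/-! ### From pointwise proportionality to a smooth factor. -/

/-- The pullback of a metric under a diffeomorphism, in the preferred chart at `p`. -/
def pullbackCoord (p : M) (y v w : 𝔼) : ℝ :=
  g'.pullbackForm f ((extChartAt (𝓡 n) p).symm y)
    (mfderiv 𝓘(ℝ, 𝔼) (𝓡 n) (extChartAt (𝓡 n) p).symm y v)
    (mfderiv 𝓘(ℝ, 𝔼) (𝓡 n) (extChartAt (𝓡 n) p).symm y w)

theorem contDiffAt_pullbackCoord (p : M) {y : 𝔼} (hy : y ∈ (extChartAt (𝓡 n) p).target)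
    (v w : 𝔼) : ContDiffAt ℝ ∞ (fun z ↦ g'.pullbackCoord f p z v w) y := by
  have hφ {z : 𝔼} (hz : z ∈ (extChartAt (𝓡 n) p).target) :=
    extChartAt_symm_contMDiffAt (n := n) p hz
  refine (g'.contDiffAt_val_mfderiv ((f.contMDiff _).comp y (hφ hy)) v w).congr_of_eventuallyEq ?_
  filter_upwards [(isOpen_extChartAt_target p).mem_nhds hy] with z hz
  rw [mfderiv_comp z ((f.contMDiff _).mdifferentiableAt (by simp))
    ((hφ hz).mdifferentiableAt (by simp))]
  rfl

theorem pullbackCoord_self (p : M) (v w : 𝔼) :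
    g'.pullbackCoord f p (extChartAt (𝓡 n) p p) v w = g'.pullbackForm f p v w := by
  rw [pullbackCoord, mfderiv_extChartAt_symm_self, extChartAt_to_inv]
  rfl

theorem coord_self_apply (p : M) (v w : 𝔼) :
    g.coord p (extChartAt (𝓡 n) p p) v w = g.form p v w := by
  rw [coord_self]; rfl

theorem pullbackCoord_eq_mul {p : M} {y : 𝔼} {μ : ℝ}
    (h : ∀ v w, g'.pullbackForm f ((extChartAt (𝓡 n) p).symm y) v w
      = μ * g.form ((extChartAt (𝓡 n) p).symm y) v w) (v w : 𝔼) :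
    g'.pullbackCoord f p y v w = μ * g.coord p y v w := h _ _

/-- Proportionality in cross-multiplied form is a closed condition: a failure at p persists on a
neighbourhood, all of whose points would then have constant curvature. -/
theorem pullbackForm_mul_form {p : M} (hK : g.NowhereOfConstantCurvature)
    (h : ∀ q : M, ¬ g.IsOfConstantCurvatureAt q →
      ∃ μ : ℝ, ∀ v w, g'.pullbackForm f q v w = μ * g.form q v w) (a b c d : 𝔼) :
    g'.pullbackForm f p a b * g.form p c d = g'.pullbackForm f p c d * g.form p a b := by
  have ht : extChartAt (𝓡 n) p p ∈ (extChartAt (𝓡 n) p).target := mem_extChartAt_target p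
  have hG (v w : 𝔼) : ContinuousAt (fun y ↦ g.coord p y v w) (extChartAt (𝓡 n) p p) :=
    (((g.contDiffAt_coord p ht).continuousAt.clm_apply continuousAt_const).clm_apply
      continuousAt_const)
  have hH (v w : 𝔼) : ContinuousAt (fun y ↦ g'.pullbackCoord f p y v w) (extChartAt (𝓡 n) p p) :=
    (g'.contDiffAt_pullbackCoord f p ht v w).continuousAt
  have hφ : Tendsto (extChartAt (𝓡 n) p) (𝓝 p) (𝓝 (extChartAt (𝓡 n) p p)) :=
    continuousAt_extChartAt p
  by_contra hne
  have hev : ∀ᶠ y in 𝓝 (extChartAt (𝓡 n) p p),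
      g'.pullbackCoord f p y a b * g.coord p y c d
        - g'.pullbackCoord f p y c d * g.coord p y a b ≠ 0 := by
    refine (((hH a b).mul (hG c d)).sub ((hH c d).mul (hG a b))).eventually_ne ?_
    simpa only [Pi.sub_apply, Pi.mul_apply, pullbackCoord_self, coord_self_apply, sub_ne_zero]
      using hne
  have hM := (hφ.eventually hev).and (extChartAt_source_mem_nhds (I := 𝓡 n) p)
  obtain ⟨U, hU, hUo, hpU⟩ := mem_nhds_iff.1 hM
  refine hK U hUo ⟨p, hpU⟩ fun q hq ↦ ?_
  by_contra hqc
  obtain ⟨hq1, hq2⟩ := hU hq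
  obtain ⟨μ, hμ⟩ := h q hqc
  have hinv := (extChartAt (𝓡 n) p).left_inv hq2
  have h2 := g.pullbackCoord_eq_mul g' f (p := p) (y := extChartAt (𝓡 n) p q) (μ := μ)
    (by rw [hinv]; exact hμ)
  apply hq1
  rw [h2, h2]
  ring

/-- Near p the factor is the quotient of the two metrics on a constant coordinate vector field that
is nonnull at p. -/
theorem contMDiff_factor (hg : g.IsIndefinite) {μ : M → ℝ}
    (hμ : ∀ p v w, g'.pullbackForm f p v w = μ p * g.form p v w) :
    ContMDiff (𝓡 n) 𝓘(ℝ, ℝ) ∞ μ := by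
  intro p
  obtain ⟨(v : 𝔼), hv⟩ := (hg p).1
  have ht : extChartAt (𝓡 n) p p ∈ (extChartAt (𝓡 n) p).target := mem_extChartAt_target p
  have hG : ContDiffAt ℝ ∞ (fun y ↦ g.coord p y v v) (extChartAt (𝓡 n) p p) :=
    ((g.contDiffAt_coord p ht).clm_apply contDiffAt_const).clm_apply contDiffAt_const
  have hG0 : g.coord p (extChartAt (𝓡 n) p p) v v ≠ 0 := by
    rw [coord_self_apply]; exact hv.ne'
  have hφ : Tendsto (extChartAt (𝓡 n) p) (𝓝 p) (𝓝 (extChartAt (𝓡 n) p p)) :=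
    continuousAt_extChartAt p
  have hq := (g'.contDiffAt_pullbackCoord f p ht v v).div hG hG0
  refine (hq.contMDiffAt.comp p contMDiffAt_extChartAt).congr_of_eventuallyEq ?_
  filter_upwards [hφ.eventually (hG.continuousAt.eventually_ne hG0),
    extChartAt_source_mem_nhds (I := 𝓡 n) p] with q hq1 hq2
  have hinv := (extChartAt (𝓡 n) p).left_inv hq2
  have h2 := g.pullbackCoord_eq_mul g' f (p := p) (y := extChartAt (𝓡 n) p q) (μ := μ q)
    (by rw [hinv]; exact hμ q) v v
  rw [Function.comp_apply, Pi.div_apply, h2, mul_div_cancel_right₀ _ hq1]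

theorem isConformal_of_factor (hg : g.IsIndefinite) {μ : M → ℝ} (hμ0 : ∀ p, μ p ≠ 0)
    (hμ : ∀ p v w, g'.pullbackForm f p v w = μ p * g.form p v w) : g.IsConformal g' f := by
  have hs := g.contMDiff_factor g' f hg hμ
  -- `Real.log` is log|·|, so σ needs no case distinction on the sign of μ.
  refine ⟨fun p ↦ if 0 < μ p then 1 else -1, fun p ↦ Real.log (μ p) / 2, ?_, fun p ↦ ?_,
    fun p ↦ ?_, fun p v w ↦ ?_⟩
  · rw [IsLocallyConstant.iff_eventually_eq]
    intro p
    rcases (hμ0 p).lt_or_gt with h | h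
    · filter_upwards [hs.continuous.continuousAt.eventually_lt_const h] with q hq
      simp [hq.not_gt, h.not_gt]
    · filter_upwards [hs.continuous.continuousAt.eventually_const_lt h] with q hq
      simp [hq, h]
  · dsimp only; split_ifs <;> simp
  · exact ((Real.contDiffAt_log.2 (hμ0 p)).div_const 2).contMDiffAt.comp p (hs p)
  · have h : (if 0 < μ p then 1 else -1) * Real.exp (2 * (Real.log (μ p) / 2)) = μ p := by
      rw [mul_div_cancel₀ _ two_ne_zero, Real.exp_log_eq_abs (hμ0 p)]
      split_ifs with h
      · rw [abs_of_pos h, one_mul]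
      · rw [abs_of_nonpos (not_lt.1 h), neg_one_mul, neg_neg]
    rw [h]
    exact hμ p v w

end PseudoRiemannianMetric

end

theorem theorem1 {n : ℕ} (hn : 3 ≤ n)
    {M : Type*} [TopologicalSpace M] [ChartedSpace (EuclideanSpace ℝ (Fin n)) M]
    [IsManifold (𝓡 n) ∞ M]
    {N : Type*} [TopologicalSpace N] [ChartedSpace (EuclideanSpace ℝ (Fin n)) N]
    [IsManifold (𝓡 n) ∞ N]
    (g : PseudoRiemannianMetric n M) (g' : PseudoRiemannianMetric n N)
    (hg : g.IsIndefinite) (hK : g.NowhereOfConstantCurvature)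
    (f : M ≃ₘ^∞⟮𝓡 n, 𝓡 n⟯ N)
    (hf : ∀ (p : M) (α₀ : Plane (TangentSpace (𝓡 n) p)), g.IsWeaklyDegeneratePlane p α₀ →
      g.LimitCondition g' f p α₀) :
    g.IsConformal g' f := by
  have hex (p : M) : ∃ μ : ℝ, μ ≠ 0 ∧ ∀ v w : EuclideanSpace ℝ (Fin n),
      g'.pullbackForm f p v w = μ * g.form p v w := by
    obtain ⟨(v₀ : EuclideanSpace ℝ (Fin n)), hv₀⟩ := (hg p).1
    have hne : g.form p v₀ v₀ ≠ 0 := hv₀.ne'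
    have h (v w : EuclideanSpace ℝ (Fin n)) : g'.pullbackForm f p v w
        = g'.pullbackForm f p v₀ v₀ / g.form p v₀ v₀ * g.form p v w := by
      have := g.pullbackForm_mul_form g' f (p := p) hK
        (fun q hq ↦ g.exists_pullbackForm_eq_mul g' f hn hg (hf q) hq) v w v₀ v₀
      field_simp
      linarith
    -- A zero factor would put v₀ in the kernel of the nondegenerate pullback.
    refine ⟨_, fun h0 ↦ ?_, h⟩
    have hv₀0 : v₀ = 0 := g'.pullbackForm_nondegenerate f p v₀ fun w ↦ by rw [h, h0, zero_mul]
    exact hne (by rw [hv₀0]; simp)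
  choose μ hμ0 hμ using hex
  exact g.isConformal_of_factor g' f hg hμ0 hμ
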